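/- Let $n\ge 1$ and let $\mathbf C\subset\mathbb R^n$ be a code, i.e. a finite set of codewords of length $n$ (for instance $\mathbf C\subset\{+1,-1\}^n$). Let $\vec X$ be a random vector in $\mathbb R^n$ with $P(\vec X\in\mathbf C)>0$, and let $\vec Z$ be a random variable with values in an arbitrary measurable space (side information about $\vec X$). Let $\vec N$ be a standard Gaussian vector in $\mathbb R^n$, with independent $\mathcal N(0,1)$ entries, that is independent of $(\vec X,\vec Z)$. For $\gamma\ge 0$ let $\vec Y=\vec Y_\gamma=\sqrt{\gamma}\,\vec X+\vec N$ be the output of the Gaussian channel with signal to noise ratio $\gamma$. Put $Q=P(\,\cdot\mid\vec X\in\mathbf C)$ and $$\phi(\vec X\mid\vec X\in\mathbf C,\vec Y,\vec Z,\gamma)=\frac1n\,E_Q\Big[\big|\vec X-E_Q[\vec X\mid\vec Y_\gamma,\vec Z]\big|^2\Big],$$ the average minimum mean squared error, where $|\cdot|$ is the Euclidean norm, and let $H(\vec X\mid\vec X\in\mathbf C,\vec Z)$ be the conditional entropy in bits of $\vec X$ given $\vec Z$ under $Q$. Then $\gamma\mapsto\phi(\vec X\mid\vec X\in\mathbf C,\vec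 Y,\vec Z,\gamma)$ is integrable on $(0,\infty)$ and $$\int_0^\infty\phi(\vec X\mid\vec X\in\mathbf C,\vec Y,\vec Z,\gamma)\,d\gamma=\frac{\ln 4}{n}\,H(\vec X\mid\vec X\in\mathbf C,\vec Z).$$ -/

import Mathlib

open MeasureTheory ProbabilityTheory

noncomputable section

namespace AreaProperty

/-- Shannon entropy, in bits, of a discrete distribution `ν`: `-∑ ν{x} log₂ ν{x}`. -/
def entropyBits {E : Type*} [MeasurableSpace E] (ν : Measure E) : ℝ :=
  (∑' x : E, Real.negMulLog (ν.real {x})) / Real.log 2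

/-- Conditional entropy `H(X | Z)`, in bits, of a discrete random variable `X` given an arbitrary
random variable `Z`: the entropy of the conditional law of `X` given `Z = z`, averaged over the
law of `Z`. -/
def condEntropyBits {Ω E F : Type*} [MeasurableSpace Ω] [MeasurableSpace E] [StandardBorelSpace E]
    [Nonempty E] [MeasurableSpace F] (X : Ω → E) (Z : Ω → F) (μ : Measure Ω) [IsFiniteMeasure μ] :
    ℝ :=
  ∫ z, entropyBits (condDistrib X Z μ z) ∂(μ.map Z)

/-- Average minimum mean squared error in estimating the `n` entries of `X` from `W`:
`(1/n) E[|X - E[X | W]|²]`. -/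
def avgMMSE {Ω F : Type*} [MeasurableSpace Ω] [MeasurableSpace F] {n : ℕ}
    (X : Ω → EuclideanSpace ℝ (Fin n)) (W : Ω → F) (μ : Measure Ω) : ℝ :=
  (1 / (n : ℝ)) *
    ∫ ω, ‖X ω - (μ[X | MeasurableSpace.comap W inferInstance]) ω‖ ^ 2 ∂μ

/-- Output of the Gaussian channel with signal to noise ratio `γ`, input `X` and noise `N`. -/
def channelOutput {Ω : Type*} {n : ℕ} (γ : ℝ) (X N : Ω → EuclideanSpace ℝ (Fin n)) :
    Ω → EuclideanSpace ℝ (Fin n) :=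
  fun ω => Real.sqrt γ • X ω + N ω

end AreaProperty

end

/-! This is an I-MMSE identity, proved separately for each codeword. Fix the side information `z`,
giving a prior `p` on the code, and a transmitted codeword `c`. With `s = √γ`, let `F(s)` be the
Gaussian mean of the log of the average over `p` of the likelihood ratios of codewords against `c`.
Stein's identity turns the derivative of `F` into `-s` times the squared error of the posterior mean
given `c`, so `-2 F(√γ)` is an antiderivative of that error. It starts at `0`, since the prior sums
to one, and tends to `-2 log (p c)`, since every other likelihood ratio dies out. This is
`integrableOn_sqError_and_integral_eq`.

Averaging over `c` gives twice the entropy of `p` in nats, and Fubini averages over `z`; `ln 4 = 2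
ln 2` accounts for bits. The link to the conditional expectation is `condExp_eq_posteriorMean`
(Bayes' rule), used through `integral_norm_sub_condExp_sq`. -/

open scoped RealInnerProductSpace

namespace AreaProperty

/-! ### Density of the standard Gaussian, tilting, and Stein's identity. -/

section Gaussian

variable {E : Type*} [NormedAddCommGroup E] [InnerProductSpace ℝ E]

variable (E) in
/-- The density of the standard Gaussian measure with respect to Lebesgue measure. -/
noncomputable def gaussianDensity (x : E) : ℝ :=
  ((2 * Real.pi) ^ ((Module.finrank ℝ E : ℝ) / 2))⁻¹ * Real.exp (-‖x‖ ^ 2 / 2)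

lemma gaussianDensity_pos (x : E) : 0 < gaussianDensity E x := by
  unfold gaussianDensity; positivity

lemma continuous_gaussianDensity : Continuous (gaussianDensity E) := by
  unfold gaussianDensity; fun_prop

lemma gaussianDensity_sub (v x : E) :
    gaussianDensity E (x - v) = gaussianDensity E x * Real.exp (⟪v, x⟫ - ‖v‖ ^ 2 / 2) := by
  unfold gaussianDensity
  rw [mul_assoc, ← Real.exp_add, norm_sub_sq_real, real_inner_comm]
  congr 2
  ring

variable [FiniteDimensional ℝ E] [MeasurableSpace E] [BorelSpace E]

lemma integrable_gaussianDensity : Integrable (gaussianDensity E) := by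
  have h := GaussianFourier.integrable_cexp_neg_mul_sq_norm_add (V := E) (b := 1 / 2)
    (by norm_num) 0 0
  have h2 := h.norm
  refine (h2.congr (ae_of_all _ fun x => ?_)).const_mul _
  simp only [Complex.norm_exp]
  congr 1
  simp [← Complex.ofReal_pow]
  ring

/-- Both finite measures have characteristic function `exp (-‖t‖² / 2)`; for the density this is the
Gaussian Fourier integral with `b = 1/2`. -/
lemma stdGaussian_eq_withDensity :
    stdGaussian E = volume.withDensity fun x => ENNReal.ofReal (gaussianDensity E x) := by
  have : IsFiniteMeasure ((volume : Measure E).withDensity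
      fun x => ENNReal.ofReal (gaussianDensity E x)) :=
    isFiniteMeasure_withDensity_ofReal integrable_gaussianDensity.2
  refine Measure.ext_of_charFun ?_
  ext t
  rw [charFun_stdGaussian, charFun_apply,
    integral_withDensity_eq_integral_toReal_smul
      (continuous_gaussianDensity.measurable.ennreal_ofReal) (by simp)]
  have h := GaussianFourier.integral_cexp_neg_mul_sq_norm_add (V := E) (b := 1 / 2)
    (by norm_num) Complex.I t
  have h0 : ((2 : ℂ) * Real.pi) ^ ((Module.finrank ℝ E : ℂ) / 2) ≠ 0 := by
    rw [Ne, Complex.cpow_eq_zero_iff]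
    simp [Real.pi_ne_zero]
  calc Complex.exp (-‖t‖ ^ 2 / 2)
      = (((2 : ℂ) * Real.pi) ^ ((Module.finrank ℝ E : ℂ) / 2))⁻¹ *
        ∫ v : E, Complex.exp (-(1 / 2) * ‖v‖ ^ 2 + Complex.I * ⟪t, v⟫) := by
        rw [h, show (Real.pi : ℂ) / (1 / 2) = 2 * Real.pi by ring, inv_mul_cancel_left₀ h0]
        congr 1
        rw [Complex.I_sq]; ring
    _ = _ := by
        rw [← integral_const_mul]
        congr 1 with x
        rw [ENNReal.toReal_ofReal (gaussianDensity_pos x).le, gaussianDensity, Complex.real_smul]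
        push_cast
        rw [mul_assoc, ← Complex.exp_add, Complex.ofReal_cpow (by positivity)]
        push_cast
        rw [real_inner_comm]
        congr 2
        ring

variable {F : Type*} [NormedAddCommGroup F] [NormedSpace ℝ F]

lemma integral_stdGaussian (f : E → F) :
    ∫ x, f x ∂(stdGaussian E) = ∫ x, gaussianDensity E x • f x := by
  rw [stdGaussian_eq_withDensity, integral_withDensity_eq_integral_toReal_smul
      (continuous_gaussianDensity.measurable.ennreal_ofReal) (by simp)]
  simp [ENNReal.toReal_ofReal (gaussianDensity_pos _).le]

lemma integrable_stdGaussian_iff {f : E → F} :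
    Integrable f (stdGaussian E) ↔ Integrable fun x => gaussianDensity E x • f x := by
  rw [stdGaussian_eq_withDensity, integrable_withDensity_iff_integrable_smul'
      (continuous_gaussianDensity.measurable.ennreal_ofReal) (by simp)]
  simp [ENNReal.toReal_ofReal (gaussianDensity_pos _).le]

/-- Translating the standard Gaussian measure is an exponential tilt. -/
lemma integral_add_stdGaussian (f : E → F) (v : E) :
    ∫ x, f (v + x) ∂(stdGaussian E)
      = ∫ x, Real.exp (⟪v, x⟫ - ‖v‖ ^ 2 / 2) • f x ∂(stdGaussian E) := by
  rw [integral_stdGaussian, integral_stdGaussian,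
    ← integral_sub_right_eq_self (fun x => gaussianDensity E x • f (v + x)) v]
  simp [gaussianDensity_sub, smul_smul]

lemma integrable_exp_smul_stdGaussian {f : E → F} (v : E)
    (hf : Integrable (fun x => f (v + x)) (stdGaussian E)) :
    Integrable (fun x => Real.exp (⟪v, x⟫ - ‖v‖ ^ 2 / 2) • f x) (stdGaussian E) := by
  rw [integrable_stdGaussian_iff] at hf ⊢
  simpa [gaussianDensity_sub, smul_smul] using hf.comp_sub_right v

lemma integrable_norm_stdGaussian : Integrable (fun x : E => ‖x‖) (stdGaussian E) :=
  IsGaussian.integrable_id.norm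

lemma integrable_norm_sq_stdGaussian : Integrable (fun x : E => ‖x‖ ^ 2) (stdGaussian E) :=
  IsGaussian.memLp_two_id.integrable_norm_pow (by norm_num)

/-- Gaussian integration by parts (Stein's identity). -/
lemma integral_inner_mul_stdGaussian {g g' : E → ℝ} {v : E}
    (hg : ∀ x, HasLineDerivAt ℝ g (g' x) x v)
    (hgi : Integrable g (stdGaussian E)) (hgi' : Integrable g' (stdGaussian E))
    (hgv : Integrable (fun x => ⟪v, x⟫ * g x) (stdGaussian E)) :
    ∫ x, ⟪v, x⟫ * g x ∂(stdGaussian E) = ∫ x, g' x ∂(stdGaussian E) := by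
  have hd (x : E) : HasLineDerivAt ℝ (gaussianDensity E) (-(gaussianDensity E x * ⟪v, x⟫)) x v := by
    have h1 : HasDerivAt (fun t : ℝ => -(‖x‖ ^ 2 + 2 * t * ⟪v, x⟫ + t ^ 2 * ‖v‖ ^ 2) / 2)
        (-⟪v, x⟫) 0 := by
      have := (((((hasDerivAt_id (0 : ℝ)).const_mul 2).mul_const ⟪v, x⟫).const_add (‖x‖ ^ 2)).add
        ((hasDerivAt_pow 2 (0 : ℝ)).mul_const (‖v‖ ^ 2))).neg.div_const 2
      refine this.congr_deriv ?_
      simp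
      ring
    have h2 := h1.exp.const_mul ((2 * Real.pi) ^ ((Module.finrank ℝ E : ℝ) / 2))⁻¹
    have h3 : (fun t : ℝ => gaussianDensity E (x + t • v)) = fun t : ℝ =>
        ((2 * Real.pi) ^ ((Module.finrank ℝ E : ℝ) / 2))⁻¹ *
          Real.exp (-(‖x‖ ^ 2 + 2 * t * ⟪v, x⟫ + t ^ 2 * ‖v‖ ^ 2) / 2) := by
      ext t
      rw [gaussianDensity, norm_add_sq_real, norm_smul, inner_smul_right, real_inner_comm, mul_pow]
      simp [mul_assoc]
    rw [HasLineDerivAt, h3]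
    refine h2.congr_deriv ?_
    simp [gaussianDensity]
    ring
  rw [integral_stdGaussian, integral_stdGaussian]
  rw [integrable_stdGaussian_iff] at hgi hgi' hgv
  have := integral_bilinear_hasLineDerivAt_right_eq_neg_left_of_integrable
    (μ := (volume : Measure E)) (B := ContinuousLinearMap.mul ℝ ℝ)
    (f := gaussianDensity E) (f' := fun x => -(gaussianDensity E x * ⟪v, x⟫)) (g := g) (g' := g')
    (v := v) ?_ ?_ ?_ (fun x _ => hd x) (fun x _ => hg x)
  · simp only [ContinuousLinearMap.mul_apply', smul_eq_mul] at this ⊢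
    rw [this, ← integral_neg]
    congr 1 with x
    ring
  · refine hgv.neg.congr (ae_of_all _ fun x => ?_)
    simp
    ring
  · exact hgi'
  · exact hgi

end Gaussian

/-! ### Partition functions and Gibbs weights of a finite prior. -/

section GibbsWeight

variable {ι : Type*} [Fintype ι]

/-- The partition function `∑ p j * exp (a j)`. -/
noncomputable def partitionFn (p a : ι → ℝ) : ℝ := ∑ j, p j * Real.exp (a j)

/-- The prior `p`, reweighted by `exp a` and normalized. -/
noncomputable def gibbsWeight (p a : ι → ℝ) (j : ι) : ℝ := p j * Real.exp (a j) / partitionFn p a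

variable {p : ι → ℝ} {i : ι}

lemma le_partitionFn (hp : ∀ j, 0 ≤ p j) (a : ι → ℝ) (i : ι) :
    p i * Real.exp (a i) ≤ partitionFn p a :=
  Finset.single_le_sum (f := fun j => p j * Real.exp (a j))
    (fun j _ => mul_nonneg (hp j) (Real.exp_pos _).le) (Finset.mem_univ i)

lemma partitionFn_nonneg (hp : ∀ j, 0 ≤ p j) (a : ι → ℝ) : 0 ≤ partitionFn p a :=
  Finset.sum_nonneg fun j _ => mul_nonneg (hp j) (Real.exp_pos _).le

lemma partitionFn_pos (hp : ∀ j, 0 ≤ p j) (hi : 0 < p i) (a : ι → ℝ) : 0 < partitionFn p a :=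
  (mul_pos hi (Real.exp_pos _)).trans_le (le_partitionFn hp a i)

lemma gibbsWeight_nonneg (hp : ∀ j, 0 ≤ p j) (a : ι → ℝ) (j : ι) : 0 ≤ gibbsWeight p a j :=
  div_nonneg (mul_nonneg (hp j) (Real.exp_pos _).le) (partitionFn_nonneg hp a)

lemma gibbsWeight_le_one (hp : ∀ j, 0 ≤ p j) (a : ι → ℝ) (j : ι) : gibbsWeight p a j ≤ 1 :=
  div_le_one_of_le₀ (le_partitionFn hp a j) (partitionFn_nonneg hp a)

lemma sum_gibbsWeight (hp : ∀ j, 0 ≤ p j) (hi : 0 < p i) (a : ι → ℝ) :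
    ∑ j, gibbsWeight p a j = 1 := by
  simp only [gibbsWeight, ← Finset.sum_div]
  exact div_self (partitionFn_pos hp hi a).ne'

/-- Normalization cancels a common factor, so log-likelihoods matter only up to a term independent
of the codeword. -/
lemma gibbsWeight_add_const (p a : ι → ℝ) (t : ℝ) :
    gibbsWeight p (fun j => a j + t) = gibbsWeight p a := by
  ext j
  simp only [gibbsWeight, partitionFn, Real.exp_add, ← mul_assoc, ← Finset.sum_mul]
  exact mul_div_mul_right _ _ (Real.exp_pos t).ne'

lemma hasDerivAt_partitionFn {a : ℝ → ι → ℝ} {a' : ι → ℝ} {t : ℝ}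
    (ha : ∀ j, HasDerivAt (fun u => a u j) (a' j) t) :
    HasDerivAt (fun u => partitionFn p (a u)) (∑ j, p j * Real.exp (a t j) * a' j) t := by
  unfold partitionFn
  refine HasDerivAt.fun_sum fun j _ => ?_
  simpa [mul_assoc] using (ha j).exp.const_mul (p j)

lemma hasDerivAt_log_partitionFn (hp : ∀ j, 0 ≤ p j) (hi : 0 < p i) {a : ℝ → ι → ℝ} {a' : ι → ℝ}
    {t : ℝ} (ha : ∀ j, HasDerivAt (fun u => a u j) (a' j) t) :
    HasDerivAt (fun u => Real.log (partitionFn p (a u))) (∑ j, gibbsWeight p (a t) j * a' j) t := by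
  refine ((hasDerivAt_partitionFn ha).log (partitionFn_pos hp hi _).ne').congr_deriv ?_
  rw [Finset.sum_div]
  exact Finset.sum_congr rfl fun j _ => by rw [gibbsWeight]; ring

lemma hasDerivAt_gibbsWeight (hp : ∀ j, 0 ≤ p j) (hi : 0 < p i) {a : ℝ → ι → ℝ} {a' : ι → ℝ}
    {t : ℝ} (ha : ∀ j, HasDerivAt (fun u => a u j) (a' j) t) (j : ι) :
    HasDerivAt (fun u => gibbsWeight p (a u) j)
      (gibbsWeight p (a t) j * (a' j - ∑ k, gibbsWeight p (a t) k * a' k)) t := by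
  have hZ := (partitionFn_pos hp hi (a t)).ne'
  refine (((ha j).exp.const_mul (p j)).div (hasDerivAt_partitionFn ha) hZ).congr_deriv ?_
  have : ∑ k, gibbsWeight p (a t) k * a' k
      = (∑ k, p k * Real.exp (a t k) * a' k) / partitionFn p (a t) := by
    rw [Finset.sum_div]
    exact Finset.sum_congr rfl fun k _ => by rw [gibbsWeight]; ring
  rw [this, gibbsWeight]
  field_simp

lemma abs_sum_gibbsWeight_mul_le (hp : ∀ j, 0 ≤ p j) (a b : ι → ℝ) :
    |∑ j, gibbsWeight p a j * b j| ≤ ∑ j, |b j| := by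
  refine (Finset.abs_sum_le_sum_abs _ _).trans (Finset.sum_le_sum fun j _ => ?_)
  rw [abs_mul, abs_of_nonneg (gibbsWeight_nonneg hp a j)]
  exact mul_le_of_le_one_left (abs_nonneg _) (gibbsWeight_le_one hp a j)

lemma norm_sum_gibbsWeight_smul_le {V : Type*} [NormedAddCommGroup V] [NormedSpace ℝ V]
    (hp : ∀ j, 0 ≤ p j) (a : ι → ℝ) (b : ι → V) :
    ‖∑ j, gibbsWeight p a j • b j‖ ≤ ∑ j, ‖b j‖ := by
  refine (norm_sum_le _ _).trans (Finset.sum_le_sum fun j _ => ?_)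
  rw [norm_smul, Real.norm_of_nonneg (gibbsWeight_nonneg hp a j)]
  exact mul_le_of_le_one_left (norm_nonneg _) (gibbsWeight_le_one hp a j)

end GibbsWeight

/-! ### The identity for a fixed prior and a fixed transmitted codeword. -/

section Channel

variable {E : Type*} [NormedAddCommGroup E] [InnerProductSpace ℝ E]
variable {ι : Type*}

/-- The log-likelihood ratio, at signal to noise ratio `s ^ 2` and noise `x`, between the codeword
at displacement `-d j` from the transmitted one and the transmitted one. -/
noncomputable def logRatio (d : ι → E) (s : ℝ) (x : E) (j : ι) : ℝ :=
  -(s * ⟪d j, x⟫) - s ^ 2 * ‖d j‖ ^ 2 / 2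

/-- Completing the square: the gap is `‖s • d j + x‖² / 2`. Being uniform in `s`, the bound supplies
the dominating function for the limit `s → ∞`. -/
lemma logRatio_le (d : ι → E) (s : ℝ) (x : E) (j : ι) : logRatio d s x j ≤ ‖x‖ ^ 2 / 2 := by
  have h := norm_add_sq_real (s • d j) x
  rw [norm_smul, inner_smul_left, mul_pow, Real.norm_eq_abs, sq_abs] at h
  simp only [conj_trivial] at h
  have := sq_nonneg ‖s • d j + x‖
  unfold logRatio
  linarith

lemma hasDerivAt_logRatio (d : ι → E) (s : ℝ) (x : E) (j : ι) :
    HasDerivAt (fun u => logRatio d u x j) (-⟪d j, x⟫ - s * ‖d j‖ ^ 2) s := by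
  unfold logRatio
  refine (((hasDerivAt_id s).mul_const ⟪d j, x⟫).neg.sub
    (((hasDerivAt_pow 2 s).mul_const (‖d j‖ ^ 2)).div_const 2)).congr_deriv ?_
  simp
  ring

lemma hasDerivAt_logRatio_add_smul (d : ι → E) (s : ℝ) (x v : E) (j : ι) :
    HasDerivAt (fun t : ℝ => logRatio d s (x + t • v) j) (-(s * ⟪d j, v⟫)) 0 := by
  unfold logRatio
  simp only [inner_add_right, inner_smul_right]
  refine (((((hasDerivAt_id (0 : ℝ)).mul_const ⟪d j, v⟫).const_add ⟪d j, x⟫).const_mul s).neg.sub_const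
    _).congr_deriv ?_
  simp

lemma continuous_logRatio (d : ι → E) (s : ℝ) : Continuous (logRatio d s) := by
  unfold logRatio
  fun_prop

lemma tendsto_logRatio_atBot {d : ι → E} {j : ι} (hj : d j ≠ 0) (x : E) :
    Filter.Tendsto (fun s => logRatio d s x j) Filter.atTop Filter.atBot := by
  have h : (fun s => logRatio d s x j) = fun s => s * (-⟪d j, x⟫ + s * (-(‖d j‖ ^ 2 / 2))) := by
    ext s; unfold logRatio; ring
  rw [h]
  refine Filter.tendsto_id.atTop_mul_atBot₀ (Filter.tendsto_atBot_add_const_left _ _ ?_)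
  refine Filter.tendsto_id.atTop_mul_const_of_neg ?_
  have : 0 < ‖d j‖ := norm_pos_iff.2 hj
  have : 0 < ‖d j‖ ^ 2 := by positivity
  linarith

variable [Fintype ι] {p : ι → ℝ} {i : ι} {d : ι → E}

/-- The transmitted codeword has displacement zero, so its term alone contributes `p i`. -/
lemma log_le_log_partitionFn (hp : ∀ j, 0 ≤ p j) (hi : 0 < p i) (hd : d i = 0) (s : ℝ) (x : E) :
    Real.log (p i) ≤ Real.log (partitionFn p (logRatio d s x)) := by
  refine Real.log_le_log hi ?_
  simpa [logRatio, hd] using le_partitionFn hp (logRatio d s x) i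

lemma log_partitionFn_le (hp : ∀ j, 0 ≤ p j) (hi : 0 < p i) (hsum : ∑ j, p j = 1) (s : ℝ)
    (x : E) : Real.log (partitionFn p (logRatio d s x)) ≤ ‖x‖ ^ 2 / 2 := by
  rw [Real.log_le_iff_le_exp (partitionFn_pos hp hi _)]
  calc partitionFn p (logRatio d s x) ≤ ∑ j, p j * Real.exp (‖x‖ ^ 2 / 2) :=
        Finset.sum_le_sum fun j _ =>
          mul_le_mul_of_nonneg_left (Real.exp_le_exp.2 (logRatio_le d s x j)) (hp j)
    _ = _ := by rw [← Finset.sum_mul, hsum, one_mul]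

lemma abs_log_partitionFn_le (hp : ∀ j, 0 ≤ p j) (hi : 0 < p i) (hd : d i = 0)
    (hsum : ∑ j, p j = 1) (s : ℝ) (x : E) :
    |Real.log (partitionFn p (logRatio d s x))| ≤ ‖x‖ ^ 2 / 2 + |Real.log (p i)| := by
  have h1 := log_le_log_partitionFn hp hi hd s x
  have h2 := log_partitionFn_le (d := d) hp hi hsum s x
  have h3 := neg_abs_le (Real.log (p i))
  have h4 := abs_nonneg (Real.log (p i))
  have h5 : 0 ≤ ‖x‖ ^ 2 / 2 := by positivity
  rw [abs_le]
  constructor <;> linarith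

lemma continuous_partitionFn_logRatio (p : ι → ℝ) (d : ι → E) (s : ℝ) :
    Continuous fun x => partitionFn p (logRatio d s x) := by
  have := continuous_logRatio d s
  unfold partitionFn
  fun_prop

lemma continuous_log_partitionFn (hp : ∀ j, 0 ≤ p j) (hi : 0 < p i) (d : ι → E) (s : ℝ) :
    Continuous fun x => Real.log (partitionFn p (logRatio d s x)) :=
  (continuous_partitionFn_logRatio p d s).log fun _ => (partitionFn_pos hp hi _).ne'

lemma continuous_gibbsWeight (hp : ∀ j, 0 ≤ p j) (hi : 0 < p i) (d : ι → E) (s : ℝ) (j : ι) :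
    Continuous fun x => gibbsWeight p (logRatio d s x) j := by
  have := continuous_logRatio d s
  exact Continuous.div (by fun_prop) (continuous_partitionFn_logRatio p d s)
    fun _ => (partitionFn_pos hp hi _).ne'

/-- For every other codeword the quadratic term `-s² ‖d j‖² / 2` beats the linear noise term, so
only the term `p i` survives. -/
lemma tendsto_partitionFn (hd : ∀ j, d j = 0 ↔ j = i) (x : E) :
    Filter.Tendsto (fun s => partitionFn p (logRatio d s x)) Filter.atTop (nhds (p i)) := by
  classical
  have : p i = ∑ j, p j * (if j = i then 1 else 0) := by simp
  unfold partitionFn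
  rw [this]
  refine tendsto_finsetSum _ fun j _ => Filter.Tendsto.const_mul _ ?_
  split_ifs with h
  · have : d j = 0 := (hd j).2 h
    simp [logRatio, this]
  · exact Real.tendsto_exp_atBot.comp (tendsto_logRatio_atBot (fun h' => h ((hd j).1 h')) x)

variable [FiniteDimensional ℝ E] [MeasurableSpace E]

/-- The mean squared distance between the transmitted codeword and the posterior mean, in terms of
the displacements `d` of the transmitted codeword from all codewords. -/
noncomputable def sqError (p : ι → ℝ) (d : ι → E) (s : ℝ) : ℝ :=
  ∫ x, ‖∑ j, gibbsWeight p (logRatio d s x) j • d j‖ ^ 2 ∂(stdGaussian E)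

lemma sqError_nonneg (p : ι → ℝ) (d : ι → E) (s : ℝ) : 0 ≤ sqError p d s :=
  integral_nonneg fun _ => sq_nonneg _

variable [BorelSpace E]

lemma integrable_gibbsWeight (hp : ∀ j, 0 ≤ p j) (hi : 0 < p i) (d : ι → E) (s : ℝ) (j : ι) :
    Integrable (fun x => gibbsWeight p (logRatio d s x) j) (stdGaussian E) :=
  Integrable.of_bound (continuous_gibbsWeight hp hi d s j).aestronglyMeasurable 1
    (ae_of_all _ fun x => by
      rw [Real.norm_of_nonneg (gibbsWeight_nonneg hp _ j)]
      exact gibbsWeight_le_one hp _ j)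

lemma integrable_inner_mul_gibbsWeight (hp : ∀ j, 0 ≤ p j) (hi : 0 < p i) (d : ι → E) (s : ℝ)
    (v : E) (j : ι) :
    Integrable (fun x => ⟪v, x⟫ * gibbsWeight p (logRatio d s x) j) (stdGaussian E) := by
  have := continuous_gibbsWeight hp hi d s j
  refine (integrable_norm_stdGaussian.const_mul ‖v‖).mono'
    (Continuous.aestronglyMeasurable (by fun_prop)) (ae_of_all _ fun x => ?_)
  rw [norm_mul, Real.norm_of_nonneg (gibbsWeight_nonneg hp _ j)]
  exact (mul_le_of_le_one_right (norm_nonneg _) (gibbsWeight_le_one hp _ j)).trans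
    (norm_inner_le_norm v x)

lemma integrable_lineDeriv_gibbsWeight (hp : ∀ j, 0 ≤ p j) (hi : 0 < p i) (d : ι → E) (s : ℝ)
    (v : E) (j : ι) :
    Integrable (fun x => gibbsWeight p (logRatio d s x) j *
      (-(s * ⟪d j, v⟫) - ∑ k, gibbsWeight p (logRatio d s x) k * -(s * ⟪d k, v⟫)))
      (stdGaussian E) := by
  have hc := continuous_gibbsWeight hp hi d s
  refine Integrable.of_bound (Continuous.aestronglyMeasurable (by fun_prop))
    (|(-(s * ⟪d j, v⟫))| + ∑ k, |(-(s * ⟪d k, v⟫))|) (ae_of_all _ fun x => ?_)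
  rw [norm_mul, Real.norm_of_nonneg (gibbsWeight_nonneg hp _ j)]
  refine (mul_le_of_le_one_left (norm_nonneg _) (gibbsWeight_le_one hp _ j)).trans ?_
  refine (norm_sub_le _ _).trans ?_
  exact add_le_add le_rfl (abs_sum_gibbsWeight_mul_le hp _ _)

lemma integral_inner_mul_gibbsWeight (hp : ∀ j, 0 ≤ p j) (hi : 0 < p i) (d : ι → E) (s : ℝ)
    (v : E) (j : ι) :
    ∫ x, ⟪v, x⟫ * gibbsWeight p (logRatio d s x) j ∂(stdGaussian E)
      = ∫ x, gibbsWeight p (logRatio d s x) j *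
          (-(s * ⟪d j, v⟫) - ∑ k, gibbsWeight p (logRatio d s x) k * -(s * ⟪d k, v⟫))
          ∂(stdGaussian E) := by
  refine integral_inner_mul_stdGaussian (fun x => ?_) (integrable_gibbsWeight hp hi d s j)
    (integrable_lineDeriv_gibbsWeight hp hi d s v j)
    (integrable_inner_mul_gibbsWeight hp hi d s v j)
  unfold HasLineDerivAt
  refine (hasDerivAt_gibbsWeight hp hi
    (fun k => hasDerivAt_logRatio_add_smul d s x v k) j).congr_deriv ?_
  simp

/-- Stein's identity applied to each `⟪d j, x⟫` produces a term `s ‖d j‖²` that cancels the explicit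
one. What remains is the double sum of `w j * w k * ⟪d j, d k⟫`, the squared norm of the weighted
displacement. -/
lemma integral_deriv_log_partitionFn (hp : ∀ j, 0 ≤ p j) (hi : 0 < p i) (d : ι → E) (s : ℝ) :
    ∫ x, ∑ j, gibbsWeight p (logRatio d s x) j * (-⟪d j, x⟫ - s * ‖d j‖ ^ 2) ∂(stdGaussian E)
      = -(s * sqError p d s) := by
  have hw := integrable_gibbsWeight hp hi d s
  have hv := integrable_inner_mul_gibbsWeight hp hi d s
  have hbd (j : ι) := integrable_lineDeriv_gibbsWeight hp hi d s (d j) j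
  have h1 (j : ι) : ∫ x, gibbsWeight p (logRatio d s x) j * (-⟪d j, x⟫ - s * ‖d j‖ ^ 2)
        ∂(stdGaussian E)
      = ∫ x, (-(gibbsWeight p (logRatio d s x) j *
      (-(s * ⟪d j, d j⟫) - ∑ k, gibbsWeight p (logRatio d s x) k * -(s * ⟪d k, d j⟫)))
        - gibbsWeight p (logRatio d s x) j * (s * ‖d j‖ ^ 2)) ∂(stdGaussian E) := by
    rw [integral_sub (hbd j).fun_neg ((hw j).mul_const _), integral_neg,
      ← integral_inner_mul_gibbsWeight hp hi d s (d j) j, ← integral_neg,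
      ← integral_sub (hv (d j) j).fun_neg ((hw j).mul_const _)]
    congr 1 with x
    ring
  rw [integral_finsetSum _ fun j _ => ?_]
  · simp_rw [h1]
    rw [← integral_finsetSum _ fun j _ => (hbd j).fun_neg.sub' ((hw j).mul_const _), sqError,
      ← integral_const_mul, ← integral_neg]
    congr 1 with x
    set w := gibbsWeight p (logRatio d s x)
    rw [← real_inner_self_eq_norm_sq, sum_inner, Finset.mul_sum, ← Finset.sum_neg_distrib]
    refine Finset.sum_congr rfl fun j _ => ?_
    rw [inner_smul_left, inner_sum, ← real_inner_self_eq_norm_sq]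
    simp only [inner_smul_right, conj_trivial, mul_neg, Finset.sum_neg_distrib]
    have : ∑ k, w k * (s * ⟪d k, d j⟫) = s * ∑ k, w k * ⟪d j, d k⟫ := by
      rw [Finset.mul_sum]
      exact Finset.sum_congr rfl fun k _ => by rw [real_inner_comm]; ring
    rw [this]
    ring
  · refine ((hv (d j) j).neg.sub ((hw j).mul_const (s * ‖d j‖ ^ 2))).congr (ae_of_all _ fun x => ?_)
    simp
    ring

lemma integrable_log_partitionFn (hp : ∀ j, 0 ≤ p j) (hi : 0 < p i) (hd : d i = 0)
    (hsum : ∑ j, p j = 1) (s : ℝ) :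
    Integrable (fun x => Real.log (partitionFn p (logRatio d s x))) (stdGaussian E) :=
  ((integrable_norm_sq_stdGaussian.div_const 2).add (integrable_const |Real.log (p i)|)).mono'
    (continuous_log_partitionFn hp hi d s).aestronglyMeasurable
    (ae_of_all _ fun x => abs_log_partitionFn_le hp hi hd hsum s x)

lemma hasDerivAt_integral_log_partitionFn (hp : ∀ j, 0 ≤ p j) (hi : 0 < p i) (hd : d i = 0)
    (hsum : ∑ j, p j = 1) (s : ℝ) :
    HasDerivAt (fun u => ∫ x, Real.log (partitionFn p (logRatio d u x)) ∂(stdGaussian E))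
      (-(s * sqError p d s)) s := by
  have hc := continuous_gibbsWeight hp hi d s
  rw [← integral_deriv_log_partitionFn hp hi]
  -- On the unit ball around `s` one has `|u| ≤ |s| + 1`, which gives a bound linear in `‖x‖`.
  refine (hasDerivAt_integral_of_dominated_loc_of_deriv_le
    (F' := fun u x => ∑ j, gibbsWeight p (logRatio d u x) j * (-⟪d j, x⟫ - u * ‖d j‖ ^ 2))
    (bound := fun x => ∑ j, (‖d j‖ * ‖x‖ + (|s| + 1) * ‖d j‖ ^ 2))
    (Metric.ball_mem_nhds s one_pos)
    (Filter.Eventually.of_forall fun u =>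
      (continuous_log_partitionFn hp hi d u).aestronglyMeasurable)
    (integrable_log_partitionFn hp hi hd hsum s)
    (Continuous.aestronglyMeasurable (by fun_prop))
    (ae_of_all _ fun x u hu => ?_) ?_ (ae_of_all _ fun x u _ => ?_)).2
  · refine (abs_sum_gibbsWeight_mul_le hp _ _).trans (Finset.sum_le_sum fun j _ => ?_)
    refine (abs_sub _ _).trans (add_le_add ?_ ?_)
    · rw [abs_neg]
      exact abs_real_inner_le_norm _ _
    · rw [abs_mul, abs_of_nonneg (sq_nonneg ‖d j‖)]
      refine mul_le_mul_of_nonneg_right ?_ (sq_nonneg _)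
      rw [Metric.mem_ball, Real.dist_eq] at hu
      have := abs_sub_abs_le_abs_sub u s
      linarith
  · exact integrable_finsetSum _ fun j _ =>
      (integrable_norm_stdGaussian.const_mul _).add (integrable_const _)
  · exact hasDerivAt_log_partitionFn hp hi fun j => hasDerivAt_logRatio d u x j

lemma tendsto_integral_log_partitionFn (hp : ∀ j, 0 ≤ p j) (hi : 0 < p i)
    (hd : ∀ j, d j = 0 ↔ j = i) (hsum : ∑ j, p j = 1) :
    Filter.Tendsto (fun s => ∫ x, Real.log (partitionFn p (logRatio d s x)) ∂(stdGaussian E))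
      Filter.atTop (nhds (Real.log (p i))) := by
  have : Real.log (p i) = ∫ _, Real.log (p i) ∂(stdGaussian E) := by simp
  rw [this]
  refine tendsto_integral_filter_of_dominated_convergence
    (fun x => ‖x‖ ^ 2 / 2 + |Real.log (p i)|)
    (Filter.Eventually.of_forall fun s =>
      (continuous_log_partitionFn hp hi d s).aestronglyMeasurable)
    (Filter.Eventually.of_forall fun s => ae_of_all _ fun x =>
      abs_log_partitionFn_le hp hi ((hd i).2 rfl) hsum s x)
    ((integrable_norm_sq_stdGaussian.div_const 2).add (integrable_const _))
    (ae_of_all _ fun x => (tendsto_partitionFn hd x).log hi.ne')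

/-- The squared error of the posterior mean, for a fixed transmitted codeword, integrates over all
signal to noise ratios to twice the self-information of that codeword. -/
lemma integrableOn_sqError_and_integral_eq (hp : ∀ j, 0 ≤ p j) (hi : 0 < p i)
    (hd : ∀ j, d j = 0 ↔ j = i) (hsum : ∑ j, p j = 1) :
    IntegrableOn (fun γ => sqError p d (Real.sqrt γ)) (Set.Ioi 0) ∧
      ∫ γ in Set.Ioi 0, sqError p d (Real.sqrt γ) = -2 * Real.log (p i) := by
  -- The factor `-2` cancels the `-s` of the derivative against the `1 / (2 √γ)` of the chain rule.
  set G : ℝ → ℝ := fun γ =>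
    -2 * ∫ x, Real.log (partitionFn p (logRatio d (Real.sqrt γ) x)) ∂(stdGaussian E) with hG
  have hder := hasDerivAt_integral_log_partitionFn hp hi ((hd i).2 rfl) hsum
  -- The square root is not differentiable at `0`, so the endpoint needs only continuity.
  have hcont : ContinuousWithinAt G (Set.Ici 0) 0 := by
    refine ContinuousAt.continuousWithinAt (ContinuousAt.mul continuousAt_const ?_)
    exact ContinuousAt.comp (f := Real.sqrt)
      (g := fun u => ∫ x, Real.log (partitionFn p (logRatio d u x)) ∂(stdGaussian E))
      (hder _).continuousAt Real.continuous_sqrt.continuousAt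
  have hderiv (γ : ℝ) (hγ : γ ∈ Set.Ioi (0 : ℝ)) :
      HasDerivAt G (sqError p d (Real.sqrt γ)) γ := by
    have hpos : 0 < Real.sqrt γ := Real.sqrt_pos.2 hγ
    refine (((hder (Real.sqrt γ)).comp γ (Real.hasDerivAt_sqrt (ne_of_gt hγ))).const_mul
      (-2)).congr_deriv ?_
    field_simp
  have hlim : Filter.Tendsto G Filter.atTop (nhds (-2 * Real.log (p i))) :=
    ((tendsto_integral_log_partitionFn hp hi hd hsum).comp Real.tendsto_sqrt_atTop).const_mul (-2)
  have hnn : ∀ γ ∈ Set.Ioi (0 : ℝ), 0 ≤ sqError p d (Real.sqrt γ) := fun γ _ => sqError_nonneg _ _ _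
  -- A nonnegative derivative whose antiderivative converges is integrable.
  refine ⟨integrableOn_Ioi_deriv_of_nonneg hcont hderiv hnn hlim, ?_⟩
  rw [integral_Ioi_of_hasDerivAt_of_nonneg hcont hderiv hnn hlim]
  simp [hG, logRatio, partitionFn, hsum]

end Channel

/-! ### Independence of the noise after conditioning on the code. -/

section Conditioning

variable {Ω α β : Type*} [MeasurableSpace Ω] [MeasurableSpace α] [MeasurableSpace β]

/-- Conditioning on an event determined by `V` preserves the law of an independent `N`, and its
independence from `V`. -/
lemma map_prod_cond_of_indepFun {P : Measure Ω} [IsProbabilityMeasure P] {N : Ω → α} {V : Ω → β}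
    (hN : Measurable N) (hV : Measurable V) (h : IndepFun N V P) {B : Set β}
    (hB : MeasurableSet B) :
    (P[|V ⁻¹' B]).map (fun ω => (N ω, V ω)) = (P.map N).prod ((P[|V ⁻¹' B]).map V) := by
  have hpre : V ⁻¹' B = (fun ω => (N ω, V ω)) ⁻¹' (Set.univ ×ˢ B) := by ext; simp
  have hjoint := h.map_prod_eq_prod_map_map hN.aemeasurable hV.aemeasurable
  have : IsProbabilityMeasure (P.map N) := Measure.isProbabilityMeasure_map hN.aemeasurable
  have : IsProbabilityMeasure (P.map V) := Measure.isProbabilityMeasure_map hV.aemeasurable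
  rw [ProbabilityTheory.cond, Measure.map_smul, Measure.map_smul, Measure.prod_smul_right,
    ← Measure.restrict_map hV hB]
  congr 1
  rw [hpre, ← Measure.restrict_map (hN.prodMk hV) (MeasurableSet.univ.prod hB), hjoint,
    ← Measure.prod_restrict, Measure.restrict_univ]

end Conditioning

/-! ### The conditional law of the codeword given the side information. -/

section Prior

variable {S Ω 𝓩 : Type*} [MeasurableSpace S] [StandardBorelSpace S] [Nonempty S]
  [MeasurableSpace Ω] [MeasurableSpace 𝓩]
variable {Q : Measure Ω} [IsProbabilityMeasure Q] {C : Finset S} {X : Ω → S} {Z : Ω → 𝓩}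

/-- The conditional probability, given `Z = z`, that `X` is the codeword `c`. -/
noncomputable def prior (Q : Measure Ω) [IsFiniteMeasure Q] (X : Ω → S) (Z : Ω → 𝓩) (C : Finset S)
    (z : 𝓩) (c : C) : ℝ :=
  (condDistrib X Z Q z).real {(c : S)}

lemma prior_nonneg (z : 𝓩) (c : C) : 0 ≤ prior Q X Z C z c := measureReal_nonneg

lemma prior_le_one (z : 𝓩) (c : C) : prior Q X Z C z c ≤ 1 := measureReal_le_one

lemma measurable_prior (c : C) : Measurable fun z => prior Q X Z C z c :=
  (Kernel.measurable_coe _ (measurableSet_singleton _)).ennreal_toReal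

lemma ae_mem_of_condDistrib (hX : Measurable X) (hXC : ∀ᵐ ω ∂Q, X ω ∈ C) :
    ∀ᵐ z ∂(Q.map Z), ∀ᵐ x ∂(condDistrib X Z Q z), x ∈ C := by
  by_cases hZ : AEMeasurable Z Q
  swap
  · simp [Measure.map_of_not_aemeasurable hZ]
  refine Measure.ae_ae_of_ae_compProd (p := fun y => y.2 ∈ C) ?_
  rw [compProd_map_condDistrib hX.aemeasurable,
    ae_map_iff (hZ.prodMk hX.aemeasurable) (show MeasurableSet {y : 𝓩 × S | y.2 ∈ C} from measurable_snd C.measurableSet)]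
  exact hXC

lemma integral_condDistrib_eq_sum {F : Type*} [NormedAddCommGroup F] [NormedSpace ℝ F]
    [CompleteSpace F] {z : 𝓩} (hz : ∀ᵐ x ∂(condDistrib X Z Q z), x ∈ C) (f : S → F) :
    ∫ x, f x ∂(condDistrib X Z Q z) = ∑ c : C, prior Q X Z C z c • f c := by
  have h : condDistrib X Z Q z = (condDistrib X Z Q z).restrict (C : Set S) :=
    (Measure.restrict_eq_self_of_ae_mem hz).symm
  rw [h, setIntegral_finset _ (IntegrableOn.finset), ← Finset.sum_coe_sort]
  rfl

lemma sum_prior {z : 𝓩} (hz : ∀ᵐ x ∂(condDistrib X Z Q z), x ∈ C) :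
    ∑ c : C, prior Q X Z C z c = 1 := by
  simpa using (integral_condDistrib_eq_sum hz fun _ => (1 : ℝ)).symm

lemma entropyBits_condDistrib {z : 𝓩} (hz : ∀ᵐ x ∂(condDistrib X Z Q z), x ∈ C) :
    entropyBits (condDistrib X Z Q z)
      = (∑ c : C, Real.negMulLog (prior Q X Z C z c)) / Real.log 2 := by
  rw [entropyBits, tsum_eq_sum (s := C), ← Finset.sum_coe_sort]
  · rfl
  · intro x hx
    have : (condDistrib X Z Q z).real {x} = 0 := by
      rw [measureReal_eq_zero_iff]
      refine measure_mono_null (fun y hy => ?_) hz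
      rw [Set.mem_singleton_iff.1 hy]
      exact hx
    simp [this]

end Prior

/-! ### Algebra of the posterior mean. -/

section PosteriorMean

lemma measurable_gibbsWeight {α ι : Type*} [MeasurableSpace α] [Fintype ι] {q a : α → ι → ℝ}
    (hq : ∀ j, Measurable fun x => q x j) (ha : ∀ j, Measurable fun x => a x j) (j : ι) :
    Measurable fun x => gibbsWeight (q x) (a x) j := by
  unfold gibbsWeight partitionFn
  fun_prop

variable {E : Type*} [NormedAddCommGroup E] [InnerProductSpace ℝ E] {C : Finset E}

/-- The posterior mean of the codeword, given the observation `y` at signal to noise ratio `s ^ 2`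
and prior `p`. -/
noncomputable def posteriorMean (C : Finset E) (p : C → ℝ) (s : ℝ) (y : E) : E :=
  ∑ c : C, gibbsWeight p (logRatio (fun c : C => -(c : E)) s y) c • (c : E)

lemma norm_posteriorMean_le {p : C → ℝ} (hp : ∀ c, 0 ≤ p c) (s : ℝ) (y : E) :
    ‖posteriorMean C p s y‖ ≤ ∑ c : C, ‖(c : E)‖ :=
  norm_sum_gibbsWeight_smul_le hp _ _

/-- After substituting `y = s • c + x`, the two exponents differ by an amount independent of `c'`.
This passes from likelihoods relative to pure noise to likelihoods relative to the transmitted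
codeword. -/
lemma gibbsWeight_logRatio_smul_add (p : C → ℝ) (s : ℝ) (x : E) (c : C) :
    gibbsWeight p (logRatio (fun c' : C => -(c' : E)) s (s • (c : E) + x))
      = gibbsWeight p (logRatio (fun c' : C => (c : E) - c') s x) := by
  rw [← gibbsWeight_add_const _ (logRatio (fun c' : C => (c : E) - c') s x)
    (s * ⟪(c : E), x⟫ + s ^ 2 * ‖(c : E)‖ ^ 2 / 2)]
  congr 1 with c'
  simp only [logRatio, norm_neg, inner_neg_left, inner_add_right, inner_smul_right, inner_sub_left,
    norm_sub_sq_real]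
  rw [real_inner_comm (c : E) (c' : E)]
  ring

lemma sub_posteriorMean {p : C → ℝ} (hp : ∀ c, 0 ≤ p c) {c : C} (hc : 0 < p c) (s : ℝ) (x : E) :
    (c : E) - posteriorMean C p s (s • (c : E) + x)
      = ∑ c' : C, gibbsWeight p (logRatio (fun c' : C => (c : E) - c') s x) c' • ((c : E) - c') := by
  rw [posteriorMean, gibbsWeight_logRatio_smul_add]
  simp only [smul_sub, Finset.sum_sub_distrib, ← Finset.sum_smul, sum_gibbsWeight hp hc, one_smul]

/-- Bayes' rule with the denominator cleared, so that it also covers `p = 0`. -/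
lemma sum_smul_posteriorMean {p : C → ℝ} (hp : ∀ c, 0 ≤ p c) (s : ℝ) (y : E) :
    ∑ c : C, (p c * Real.exp (logRatio (fun c : C => -(c : E)) s y c)) • posteriorMean C p s y
      = ∑ c : C, (p c * Real.exp (logRatio (fun c : C => -(c : E)) s y c)) • (c : E) := by
  by_cases h : ∀ c, p c = 0
  · simp [h]
  push Not at h
  obtain ⟨i, hi⟩ := h
  have hZ := partitionFn_pos hp (lt_of_le_of_ne (hp i) hi.symm)
    (logRatio (fun c : C => -(c : E)) s y)
  rw [← Finset.sum_smul, posteriorMean, Finset.smul_sum]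
  refine Finset.sum_congr rfl fun c _ => ?_
  rw [smul_smul, gibbsWeight]
  congr 1
  change partitionFn p _ * _ = _
  field_simp

variable [FiniteDimensional ℝ E] [MeasurableSpace E] [BorelSpace E]

lemma measurable_posteriorMean {α : Type*} [MeasurableSpace α] {q : α → C → ℝ} {y : α → E}
    (hq : ∀ c, Measurable fun x => q x c) (hy : Measurable y) (s : ℝ) :
    Measurable fun x => posteriorMean C (q x) s (y x) := by
  unfold posteriorMean
  refine Finset.measurable_sum _ fun c _ => Measurable.smul_const ?_ _
  refine measurable_gibbsWeight hq (fun c => ?_) c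
  unfold logRatio
  fun_prop

end PosteriorMean

/-! ### Disintegration over side information, codeword and noise. -/

section SideInformation

variable {E : Type*} [NormedAddCommGroup E] [InnerProductSpace ℝ E] [FiniteDimensional ℝ E]
  [MeasurableSpace E] [BorelSpace E] [StandardBorelSpace E]
variable {Ω 𝓩 : Type*} [MeasurableSpace Ω] [MeasurableSpace 𝓩]
variable {Q : Measure Ω} [IsProbabilityMeasure Q] {C : Finset E} {X N : Ω → E} {Z : Ω → 𝓩}

/-- Integrating out the noise and the codeword. -/
lemma integral_joint_eq {F : Type*} [NormedAddCommGroup F] [NormedSpace ℝ F] [CompleteSpace F]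
    (hX : Measurable X) (hN : Measurable N) (hZ : Measurable Z) (hXC : ∀ᵐ ω ∂Q, X ω ∈ C)
    (hjoint : Q.map (fun ω => (N ω, (X ω, Z ω))) =
      (stdGaussian E).prod (Q.map fun ω => (X ω, Z ω)))
    {h : E → 𝓩 → E → F} (hm : StronglyMeasurable fun q : E × 𝓩 × E => h q.1 q.2.1 q.2.2)
    (hi : Integrable (fun ω => h (X ω) (Z ω) (N ω)) Q) :
    ∫ ω, h (X ω) (Z ω) (N ω) ∂Q
      = ∫ z, ∑ c : C, prior Q X Z C z c • ∫ x, h c z x ∂(stdGaussian E) ∂(Q.map Z) := by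
  have hXZ : Measurable fun ω => (X ω, Z ω) := hX.prodMk hZ
  have hNXZ : Measurable fun ω => (N ω, (X ω, Z ω)) := hN.prodMk hXZ
  have hm' : StronglyMeasurable fun q : E × E × 𝓩 => h q.2.1 q.2.2 q.1 :=
    hm.comp_measurable (g := fun q : E × E × 𝓩 => (q.2.1, q.2.2, q.1)) (by fun_prop)
  have hmap := integral_map hNXZ.aemeasurable (hm'.aestronglyMeasurable (μ := Q.map _))
  have hint := (integrable_map_measure (hm'.aestronglyMeasurable (μ := Q.map _))
    hNXZ.aemeasurable).2 hi
  rw [hjoint] at hmap hint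
  have : IsProbabilityMeasure (Q.map Z) := Measure.isProbabilityMeasure_map hZ.aemeasurable
  have : IsProbabilityMeasure (Q.map fun ω => (X ω, Z ω)) :=
    Measure.isProbabilityMeasure_map hXZ.aemeasurable
  rw [← hmap, integral_prod_symm _ hint]
  have hint2 := hint.integral_prod_right
  -- `condDistrib X Z` disintegrates the law of the pair with `Z` first.
  have hswap : Q.map (fun ω => (X ω, Z ω)) = (Q.map fun ω => (Z ω, X ω)).map Prod.swap := by
    rw [Measure.map_map measurable_swap (hZ.prodMk hX)]
    rfl
  have hmg : StronglyMeasurable fun q : E × 𝓩 => ∫ x, h q.1 q.2 x ∂(stdGaussian E) :=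
    hm'.integral_prod_left'
  rw [hswap, integral_map measurable_swap.aemeasurable hmg.aestronglyMeasurable]
  rw [hswap, integrable_map_measure hmg.aestronglyMeasurable measurable_swap.aemeasurable] at hint2
  rw [← compProd_map_condDistrib hX.aemeasurable] at hint2 ⊢
  refine (Measure.integral_compProd hint2).trans (integral_congr_ae ?_)
  filter_upwards [ae_mem_of_condDistrib hX hXC] with z hz
  exact integral_condDistrib_eq_sum hz _

end SideInformation

/-! ### From the posterior mean to the minimum mean squared error. -/

section MMSE

lemma ae_norm_le_sum_norm {E Ω : Type*} [NormedAddCommGroup E] [MeasurableSpace Ω]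
    {Q : Measure Ω} {C : Finset E} {X : Ω → E} (hXC : ∀ᵐ ω ∂Q, X ω ∈ C) :
    ∀ᵐ ω ∂Q, ‖X ω‖ ≤ ∑ c : C, ‖(c : E)‖ := by
  filter_upwards [hXC] with ω hω
  exact Finset.single_le_sum (f := fun c : C => ‖(c : E)‖) (fun _ _ => norm_nonneg _)
    (Finset.mem_univ ⟨X ω, hω⟩)

variable {E : Type*} [NormedAddCommGroup E] [InnerProductSpace ℝ E] [FiniteDimensional ℝ E]
  [MeasurableSpace E] {C : Finset E}

/-- The mean squared error of the posterior mean when the codeword has prior `p`. -/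
noncomputable def meanSqError (C : Finset E) (p : C → ℝ) (s : ℝ) : ℝ :=
  ∑ c : C, p c * sqError p (fun c' : C => (c : E) - c') s

lemma meanSqError_nonneg {p : C → ℝ} (hp : ∀ c, 0 ≤ p c) (s : ℝ) : 0 ≤ meanSqError C p s :=
  Finset.sum_nonneg fun c _ => mul_nonneg (hp c) (sqError_nonneg _ _ _)

variable [BorelSpace E]

lemma integrableOn_meanSqError_and_integral_eq {p : C → ℝ} (hp : ∀ c, 0 ≤ p c)
    (hsum : ∑ c, p c = 1) :
    IntegrableOn (fun γ => meanSqError C p (Real.sqrt γ)) (Set.Ioi 0) ∧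
      ∫ γ in Set.Ioi 0, meanSqError C p (Real.sqrt γ) = 2 * ∑ c, Real.negMulLog (p c) := by
  have h (c : C) : IntegrableOn
      (fun γ => p c * sqError p (fun c' : C => (c : E) - c') (Real.sqrt γ)) (Set.Ioi 0) ∧
      ∫ γ in Set.Ioi 0, p c * sqError p (fun c' : C => (c : E) - c') (Real.sqrt γ)
        = 2 * Real.negMulLog (p c) := by
    -- A codeword of prior zero contributes zero to both sides; its own error integral is never
    -- needed.
    rcases (hp c).eq_or_lt with h0 | h0
    · simp [← h0]
    · have := integrableOn_sqError_and_integral_eq (d := fun c' : C => (c : E) - c') hp h0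
        (fun c' => by rw [sub_eq_zero, SetLike.coe_eq_coe, eq_comm]) hsum
      refine ⟨this.1.const_mul _, ?_⟩
      rw [integral_const_mul, this.2, Real.negMulLog]
      ring
  refine ⟨integrable_finsetSum _ fun c _ => (h c).1, ?_⟩
  simp only [meanSqError]
  rw [integral_finsetSum _ fun c _ => (h c).1, Finset.mul_sum]
  exact Finset.sum_congr rfl fun c _ => (h c).2

/-- With displacement `-c`, `exp (logRatio ..)` is the density of the output law given `c` relative
to pure noise, so all codewords share one reference measure. -/
lemma integral_smul_add_eq_exp_smul {F : Type*} [NormedAddCommGroup F] [NormedSpace ℝ F] (f : E → F)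
    (s : ℝ) (c : C) :
    ∫ x, f (s • (c : E) + x) ∂(stdGaussian E)
      = ∫ y, Real.exp (logRatio (fun c : C => -(c : E)) s y c) • f y ∂(stdGaussian E) := by
  rw [integral_add_stdGaussian]
  congr 1 with y
  simp [logRatio, inner_smul_left, norm_smul, mul_pow]

lemma integrable_exp_logRatio_smul {F : Type*} [NormedAddCommGroup F] [NormedSpace ℝ F] {f : E → F}
    (hf : StronglyMeasurable f) {K : ℝ} (hK : ∀ y, ‖f y‖ ≤ K) (s : ℝ) (c : C) :
    Integrable (fun y => Real.exp (logRatio (fun c : C => -(c : E)) s y c) • f y)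
      (stdGaussian E) := by
  have h := integrable_exp_smul_stdGaussian (f := f) (s • (c : E)) (Integrable.of_bound
    (hf.comp_measurable (measurable_const_add _)).aestronglyMeasurable K (ae_of_all _ fun x => hK _))
  simpa [logRatio, inner_smul_left, norm_smul, mul_pow] using h

/-- The posterior mean and the codeword have the same integral over every event determined by the
observation. -/
lemma sum_prior_smul_integral_indicator {p : C → ℝ} (hp : ∀ c, 0 ≤ p c) (s : ℝ) {B : Set E}
    (hB : MeasurableSet B) :
    ∑ c : C, p c • ∫ x, B.indicator (posteriorMean C p s) (s • (c : E) + x) ∂(stdGaussian E)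
      = ∑ c : C, p c • ∫ x, B.indicator (fun _ => (c : E)) (s • (c : E) + x) ∂(stdGaussian E) := by
  have hpm : StronglyMeasurable (B.indicator (posteriorMean C p s)) :=
    ((measurable_posteriorMean (q := fun _ => p) (y := fun y => y) (fun _ => measurable_const)
      measurable_id s).indicator hB).stronglyMeasurable
  have hcm (c : C) : StronglyMeasurable (B.indicator fun _ => (c : E)) :=
    (measurable_const.indicator hB).stronglyMeasurable
  have h1 (c : C) := integrable_exp_logRatio_smul hpm (K := ∑ c : C, ‖(c : E)‖)
    (fun y => (norm_indicator_le_norm_self _ _).trans (norm_posteriorMean_le hp s y)) s c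
  have h2 (c : C) := integrable_exp_logRatio_smul (hcm c) (K := ‖(c : E)‖)
    (fun y => norm_indicator_le_norm_self _ _) s c
  simp_rw [integral_smul_add_eq_exp_smul, ← integral_smul]
  rw [← integral_finsetSum _ fun c _ => (h1 c).fun_smul (p c),
    ← integral_finsetSum _ fun c _ => (h2 c).fun_smul (p c)]
  congr 1 with y
  by_cases hy : y ∈ B
  · simpa [hy, smul_smul] using sum_smul_posteriorMean hp s y
  · simp [hy]

variable [StandardBorelSpace E] {Ω 𝓩 : Type*} [MeasurableSpace Ω] [MeasurableSpace 𝓩]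
  {Q : Measure Ω} [IsProbabilityMeasure Q] {X N : Ω → E} {Z : Ω → 𝓩}

lemma stronglyMeasurable_meanSqError :
    StronglyMeasurable fun w : 𝓩 × ℝ => meanSqError C (prior Q X Z C w.1) (Real.sqrt w.2) := by
  unfold meanSqError
  refine Finset.stronglyMeasurable_fun_sum _ fun c _ =>
    ((measurable_prior c).comp measurable_fst).stronglyMeasurable.mul ?_
  refine StronglyMeasurable.integral_prod_right (Measurable.stronglyMeasurable ?_)
  refine (Measurable.norm ?_).pow_const 2
  refine Finset.measurable_sum _ fun c' _ => Measurable.smul_const ?_ _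
  refine measurable_gibbsWeight (fun c' => (measurable_prior c').comp (by fun_prop))
    (fun c' => ?_) c'
  unfold logRatio
  fun_prop

/-- The error of the posterior mean, averaged over the side information, integrates over all signal
to noise ratios to twice the conditional entropy in nats. -/
lemma integrableOn_integral_meanSqError_and_integral_eq (hX : Measurable X) (hZ : Measurable Z)
    (hXC : ∀ᵐ ω ∂Q, X ω ∈ C) :
    IntegrableOn (fun γ => ∫ z, meanSqError C (prior Q X Z C z) (Real.sqrt γ) ∂(Q.map Z))
        (Set.Ioi 0) ∧
      ∫ γ in Set.Ioi 0, ∫ z, meanSqError C (prior Q X Z C z) (Real.sqrt γ) ∂(Q.map Z)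
        = Real.log 4 * condEntropyBits X Z Q := by
  have : IsProbabilityMeasure (Q.map Z) := Measure.isProbabilityMeasure_map hZ.aemeasurable
  have hae : ∀ᵐ z ∂(Q.map Z), ∀ᵐ x ∂(condDistrib X Z Q z), x ∈ C := ae_mem_of_condDistrib hX hXC
  have hent : Integrable (fun z => 2 * ∑ c : C, Real.negMulLog (prior Q X Z C z c)) (Q.map Z) := by
    refine (integrable_finsetSum _ fun c _ => ?_).const_mul 2
    refine Integrable.of_bound
      (Real.continuous_negMulLog.measurable.comp (measurable_prior c)).aestronglyMeasurable 1
      (ae_of_all _ fun z => ?_)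
    rw [Real.norm_of_nonneg (Real.negMulLog_nonneg (prior_nonneg z c) (prior_le_one z c))]
    have h := Real.negMulLog_le_one_sub_self (prior_nonneg (Q := Q) (X := X) (Z := Z) z c)
    have := prior_nonneg (Q := Q) (X := X) (Z := Z) z c
    linarith
  have hint : Integrable
      (Function.uncurry fun z γ => meanSqError C (prior Q X Z C z) (Real.sqrt γ))
      ((Q.map Z).prod (volume.restrict (Set.Ioi 0))) := by
    -- The integrand is nonnegative, so its norm integrates over `γ` to twice the entropy given `z`,
    -- which is bounded in `z`.
    refine (integrable_prod_iff stronglyMeasurable_meanSqError.aestronglyMeasurable).2 ⟨?_, ?_⟩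
    · filter_upwards [hae] with z hz
      exact (integrableOn_meanSqError_and_integral_eq (prior_nonneg z) (sum_prior hz)).1
    · refine hent.congr ?_
      filter_upwards [hae] with z hz
      rw [← (integrableOn_meanSqError_and_integral_eq (prior_nonneg z) (sum_prior hz)).2]
      congr 1 with γ
      exact (Real.norm_of_nonneg (meanSqError_nonneg (prior_nonneg z) _)).symm
  refine ⟨hint.integral_prod_right, ?_⟩
  rw [← integral_integral_swap hint, condEntropyBits, ← integral_const_mul]
  refine integral_congr_ae ?_
  filter_upwards [hae] with z hz
  rw [(integrableOn_meanSqError_and_integral_eq (prior_nonneg z) (sum_prior hz)).2,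
    entropyBits_condDistrib hz, show (4 : ℝ) = 2 ^ 2 by norm_num, Real.log_pow]
  have : Real.log 2 ≠ 0 := (Real.log_pos one_lt_two).ne'
  push_cast
  field_simp

variable [CompleteSpace E]

/-- The conditional expectation is characterized by its integrals over events `(Y, Z) ∈ A`.
Disintegrating over `z` reduces these to the slices of `A`, where
`sum_prior_smul_integral_indicator` applies. -/
lemma condExp_eq_posteriorMean (hX : Measurable X) (hN : Measurable N) (hZ : Measurable Z)
    (hXC : ∀ᵐ ω ∂Q, X ω ∈ C)
    (hjoint : Q.map (fun ω => (N ω, (X ω, Z ω))) =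
      (stdGaussian E).prod (Q.map fun ω => (X ω, Z ω))) (s : ℝ) :
    Q[X | MeasurableSpace.comap (fun ω => (s • X ω + N ω, Z ω)) inferInstance]
      =ᵐ[Q] fun ω => posteriorMean C (prior Q X Z C (Z ω)) s (s • X ω + N ω) := by
  have hW : Measurable fun ω => (s • X ω + N ω, Z ω) := by fun_prop
  have hpm : Measurable fun w : E × 𝓩 => posteriorMean C (prior Q X Z C w.2) s w.1 :=
    measurable_posteriorMean (fun c => (measurable_prior c).comp measurable_snd) measurable_fst s
  have hbound := ae_norm_le_sum_norm hXC
  have hpmi : Integrable (fun ω => posteriorMean C (prior Q X Z C (Z ω)) s (s • X ω + N ω)) Q :=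
    Integrable.of_bound (hpm.comp hW).aestronglyMeasurable _
      (ae_of_all _ fun ω => norm_posteriorMean_le (prior_nonneg _) s _)
  have hXi : Integrable X Q := Integrable.of_bound hX.aestronglyMeasurable _ hbound
  symm
  refine ae_eq_condExp_of_forall_setIntegral_eq hW.comap_le hXi
    (fun _ _ _ => hpmi.integrableOn) ?_ ?_
  · rintro _ ⟨A, hA, rfl⟩ -
    have hAm : MeasurableSet ((fun ω => (s • X ω + N ω, Z ω)) ⁻¹' A) := hW hA
    have hsec (z : 𝓩) : MeasurableSet {y : E | (y, z) ∈ A} :=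
      hA.preimage (measurable_id.prodMk measurable_const)
    rw [← integral_indicator hAm, ← integral_indicator hAm]
    have hmap : Measurable fun q : E × 𝓩 × E => (s • q.1 + q.2.2, q.2.1) := by fun_prop
    have e1 := integral_joint_eq hX hN hZ hXC hjoint
      (h := fun x z y => {y : E | (y, z) ∈ A}.indicator
        (posteriorMean C (prior Q X Z C z) s) (s • x + y))
      (((hpm.indicator hA).comp hmap).stronglyMeasurable) (hpmi.indicator hAm)
    have e2 := integral_joint_eq hX hN hZ hXC hjoint
      (h := fun x z y => {y : E | (y, z) ∈ A}.indicator (fun _ => x) (s • x + y))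
      (measurable_fst.indicator (hmap hA)).stronglyMeasurable (hXi.indicator hAm)
    refine e1.trans (Eq.trans ?_ e2.symm)
    congr 1 with z
    exact sum_prior_smul_integral_indicator (prior_nonneg z) s (hsec z)
  · exact (hpm.stronglyMeasurable.comp_measurable
      (comap_measurable fun ω => (s • X ω + N ω, Z ω))).aestronglyMeasurable

lemma integral_norm_sub_condExp_sq (hX : Measurable X) (hN : Measurable N) (hZ : Measurable Z)
    (hXC : ∀ᵐ ω ∂Q, X ω ∈ C)
    (hjoint : Q.map (fun ω => (N ω, (X ω, Z ω))) =
      (stdGaussian E).prod (Q.map fun ω => (X ω, Z ω))) (s : ℝ) :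
    ∫ ω, ‖X ω - (Q[X | MeasurableSpace.comap (fun ω => (s • X ω + N ω, Z ω)) inferInstance]) ω‖ ^ 2
        ∂Q = ∫ z, meanSqError C (prior Q X Z C z) s ∂(Q.map Z) := by
  have hpm : Measurable fun q : E × 𝓩 × E =>
      posteriorMean C (prior Q X Z C q.2.1) s (s • q.1 + q.2.2) :=
    measurable_posteriorMean (fun c => (measurable_prior c).comp (by fun_prop)) (by fun_prop) s
  have hm : Measurable fun q : E × 𝓩 × E =>
      ‖q.1 - posteriorMean C (prior Q X Z C q.2.1) s (s • q.1 + q.2.2)‖ ^ 2 :=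
    (measurable_fst.sub hpm).norm.pow_const 2
  have e := integral_joint_eq hX hN hZ hXC hjoint
    (h := fun x z y => ‖x - posteriorMean C (prior Q X Z C z) s (s • x + y)‖ ^ 2)
    hm.stronglyMeasurable ?_
  · rw [← integral_congr_ae (f := fun ω =>
      ‖X ω - posteriorMean C (prior Q X Z C (Z ω)) s (s • X ω + N ω)‖ ^ 2), e]
    · congr 1 with z
      refine Finset.sum_congr rfl fun c _ => ?_
      rw [smul_eq_mul]
      -- Writing the error as a weighted displacement needs the weights to sum to one, hence a
      -- positive prior; the other codewords carry no mass.
      rcases (prior_nonneg (Q := Q) (X := X) (Z := Z) z c).eq_or_lt with h0 | h0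
      · simp [← h0]
      · simp_rw [sub_posteriorMean (prior_nonneg z) h0]
        rfl
    · filter_upwards [condExp_eq_posteriorMean hX hN hZ hXC hjoint s] with ω hω
      rw [hω]
  · refine Integrable.of_bound
      (hm.comp (hX.prodMk (hZ.prodMk hN))).aestronglyMeasurable
      ((∑ c : C, ‖(c : E)‖ + ∑ c : C, ‖(c : E)‖) ^ 2) ?_
    filter_upwards [ae_norm_le_sum_norm hXC] with ω hω
    rw [norm_pow, norm_norm]
    gcongr
    exact (norm_sub_le _ _).trans (add_le_add hω (norm_posteriorMean_le (prior_nonneg _) s _))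

end MMSE

end AreaProperty

theorem theorem1 {Ω 𝓩 : Type*} [MeasurableSpace Ω] [MeasurableSpace 𝓩]
    (P : Measure Ω) [IsProbabilityMeasure P]
    (n : ℕ) (hn : 0 < n)
    (C : Set (EuclideanSpace ℝ (Fin n))) (hC : C.Finite)
    (X N : Ω → EuclideanSpace ℝ (Fin n)) (Z : Ω → 𝓩)
    (hX : Measurable X) (hN : Measurable N) (hZ : Measurable Z)
    (hXC : P (X ⁻¹' C) ≠ 0)
    (hNlaw : P.map N = stdGaussian (EuclideanSpace ℝ (Fin n)))
    (hindep : IndepFun N (fun ω => (X ω, Z ω)) P) :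
    IntegrableOn
      (fun γ : ℝ => AreaProperty.avgMMSE X
        (fun ω => (AreaProperty.channelOutput γ X N ω, Z ω)) (P[|X ⁻¹' C]))
      (Set.Ioi 0) volume ∧
    ∫ γ in Set.Ioi (0 : ℝ), AreaProperty.avgMMSE X
        (fun ω => (AreaProperty.channelOutput γ X N ω, Z ω)) (P[|X ⁻¹' C])
      = Real.log 4 / (n : ℝ) * AreaProperty.condEntropyBits X Z (P[|X ⁻¹' C]) := by
  obtain ⟨C, rfl⟩ := hC.exists_finset_coe
  have hQ : IsProbabilityMeasure (P[|X ⁻¹' C]) := cond_isProbabilityMeasure hXC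
  have hXC' : ∀ᵐ ω ∂(P[|X ⁻¹' C]), X ω ∈ C := ae_cond_mem (hX C.measurableSet)
  -- The event `X ∈ C` is read as an event of the pair `(X, Z)`, of which the noise is independent.
  have hjoint := AreaProperty.map_prod_cond_of_indepFun hN (hX.prodMk hZ) hindep
    (measurable_fst C.measurableSet)
  rw [hNlaw] at hjoint
  have hmmse (γ : ℝ) : AreaProperty.avgMMSE X
      (fun ω => (AreaProperty.channelOutput γ X N ω, Z ω)) (P[|X ⁻¹' C]) = 1 / (n : ℝ) *
        ∫ z, AreaProperty.meanSqError C (AreaProperty.prior (P[|X ⁻¹' C]) X Z C z) (Real.sqrt γ)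
          ∂((P[|X ⁻¹' C]).map Z) := by
    rw [← AreaProperty.integral_norm_sub_condExp_sq hX hN hZ hXC' hjoint]
    rfl
  have h := AreaProperty.integrableOn_integral_meanSqError_and_integral_eq hX hZ hXC'
  simp_rw [hmmse]
  refine ⟨h.1.const_mul _, ?_⟩
  rw [integral_const_mul, h.2]
  ring
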